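/- Let $n\ge 2$. A Young function is a convex, continuous, non-constant function $A:[0,\infty)\to[0,\infty]$ with $A(0)=0$; its left-continuous inverse is $A^{-1}(t)=\inf\{\tau\ge 0: A(\tau)\ge t\}$. Let $\varphi:\mathbb R^n\times[0,\infty)\to[0,\infty]$ be a generalized Young function, i.e. $\varphi(x,\cdot)$ is a Young function for a.e. $x$ and $\varphi(\cdot,t)$ is measurable for every $t\ge 0$; $\varphi^{-1}(x,\cdot)$ denotes the left-continuous inverse of $\varphi(x,\cdot)$. Assume: (A0) there is $\beta\in(0,1]$ such that $\beta\le\varphi^{-1}(x,1)\le 1/\beta$ for a.e. $x\in\mathbb R^n$; (A1) there is $\beta\in(0,1]$ such that, for every ball $B\subset\mathbb R^n$ with $|B|\le 1$ and every $t\in[1,1/|B|]$, $\beta\varphi^{-1}(x,t)\le\varphi^{-1}(y,t)$ for a.e. $x,y\in B$; (A2) for every $s>0$ there are $\beta\in(0,1]$ and $h\in L^1(\mathbb R^n)\cap L^\infty(\mathbb R^n)$ such that $\beta\varphi^{-1}(x,t)\le\varphi^{-1}(y,t)$ for a.e. $x,y\in\mathbb R^n$ and every $t\ge 0$ with $h(x)+h(y)\le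 t\le s$. Let $\varphi_\infty(t)=\limsup_{|x|\to\infty}\varphi(x,t)$ for $t\ge 0$, where the upper limit is understood in the essential sense (null sets of points $x$ are disregarded). Let $L^{\varphi(\cdot)}(\mathbb R^n)$ be the space of measurable $f$ with $\int_{\mathbb R^n}\varphi(x,|f(x)|/\lambda)\,dx<\infty$ for some $\lambda>0$, with norm $\|f\|_{L^{\varphi(\cdot)}(\mathbb R^n)}=\inf\{\lambda>0:\int_{\mathbb R^n}\varphi(x,|f(x)|/\lambda)\,dx\le 1\}$, and let $V^{1,\varphi(\cdot)}_d(\mathbb R^n)$ be the space of those $u\in W^{1,1}_{\rm loc}(\mathbb R^n)$ such that $|\nabla u|\in L^{\varphi(\cdot)}(\mathbb R^n)$ and $|\{|u|>t\}|<\infty$ for every $t>0$. A normed function lattice $Y(\mathbb R^n)$ is a linear space of measurable functions (identified when equal a.e.) with a norm such that $\|u\|_{Y(\mathbb R^n)}\le\|v\|_{Y(\mathbb R^n)}$ whenever $u,v\in Y(\mathbb R^n)$ and $|u|\le|v|$ a.e. Suppose that there are a normed function lattice $Y(\mathbb R^n)$ and a constant $c$ such that every $u\in V^{1,\varphi(\cdot)}_d(\mathbb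 R^n)$ belongs to $Y(\mathbb R^n)$ and satisfies $$\|u\|_{Y(\mathbb R^n)}\le c\,\|\nabla u\|_{L^{\varphi(\cdot)}(\mathbb R^n)}.$$ Then $$\int_0\Big(\frac{t}{\varphi_\infty(t)}\Big)^{\frac1{n-1}}\,dt<\infty,$$ i.e. this integral over $(0,\delta)$ is finite for some $\delta>0$, with the conventions $t/0=\infty$ and $t/\infty=0$ for $t>0$. -/

import Mathlib

open MeasureTheory Filter Set
open scoped NNReal ENNReal ContDiff

/-- A Young function `A : [0,∞) → [0,∞]`: convex, continuous, non-constant, with `A 0 = 0`. -/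
structure IsYoung (A : ℝ≥0 → ℝ≥0∞) : Prop where
  convex : ConvexOn ℝ≥0 univ A
  continuous : Continuous A
  nonconst : ∃ s t, A s ≠ A t
  zero : A 0 = 0

/-- The left-continuous inverse `A⁻¹ t = inf {τ ≥ 0 : A τ ≥ t}`. The set is nonempty for every
Young function `A`, since such a function tends to `∞`. -/
noncomputable def leftInv (A : ℝ≥0 → ℝ≥0∞) (t : ℝ≥0) : ℝ≥0 :=
  sInf {τ : ℝ≥0 | (t : ℝ≥0∞) ≤ A τ}

section

variable {n : ℕ}

/-- A generalized Young function on `ℝⁿ × [0,∞)`. Almost everywhere measurability with respect to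
`volume` is Lebesgue measurability. -/
structure IsGenYoung (φ : EuclideanSpace ℝ (Fin n) → ℝ≥0 → ℝ≥0∞) : Prop where
  young : ∀ᵐ x, IsYoung (φ x)
  measurable : ∀ t, AEMeasurable (fun x => φ x t) volume

/-- The weight condition (A0). -/
def CondA0 (φ : EuclideanSpace ℝ (Fin n) → ℝ≥0 → ℝ≥0∞) : Prop :=
  ∃ β : ℝ≥0, 0 < β ∧ β ≤ 1 ∧ ∀ᵐ x, β ≤ leftInv (φ x) 1 ∧ leftInv (φ x) 1 ≤ 1 / β

/-- The local continuity condition (A1). -/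
def CondA1 (φ : EuclideanSpace ℝ (Fin n) → ℝ≥0 → ℝ≥0∞) : Prop :=
  ∃ β : ℝ≥0, 0 < β ∧ β ≤ 1 ∧
    ∀ (z : EuclideanSpace ℝ (Fin n)) (r : ℝ), 0 < r → volume (Metric.ball z r) ≤ 1 →
      ∀ t : ℝ≥0, 1 ≤ t → (t : ℝ≥0∞) ≤ 1 / volume (Metric.ball z r) →
        ∀ᵐ x ∂(volume.restrict (Metric.ball z r)), ∀ᵐ y ∂(volume.restrict (Metric.ball z r)),
          β * leftInv (φ x) t ≤ leftInv (φ y) t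

/-- The decay condition (A2). -/
def CondA2 (φ : EuclideanSpace ℝ (Fin n) → ℝ≥0 → ℝ≥0∞) : Prop :=
  ∀ s : ℝ≥0, 0 < s → ∃ β : ℝ≥0, 0 < β ∧ β ≤ 1 ∧ ∃ h : EuclideanSpace ℝ (Fin n) → ℝ,
    MemLp h 1 volume ∧ MemLp h ⊤ volume ∧
      ∀ᵐ x, ∀ᵐ y, ∀ t : ℝ≥0, h x + h y ≤ (t : ℝ) → t ≤ s →
        β * leftInv (φ x) t ≤ leftInv (φ y) t

/-- `φ_∞(t) = limsup_{|x| → ∞} φ(x,t)`. As `φ(x,·)` is only controlled for a.e. `x`, the upper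
limit is the essential one, that is, it disregards null sets of points `x`; it never exceeds the
upper limit over all points `x`. -/
noncomputable def phiInf (φ : EuclideanSpace ℝ (Fin n) → ℝ≥0 → ℝ≥0∞) (t : ℝ≥0) : ℝ≥0∞ :=
  limsup (fun x => φ x t) (Bornology.cobounded (EuclideanSpace ℝ (Fin n)) ⊓ ae volume)

/-- `∫ φ(x, |f(x)| / l) dx`. -/
noncomputable def modular (φ : EuclideanSpace ℝ (Fin n) → ℝ≥0 → ℝ≥0∞)
    (f : EuclideanSpace ℝ (Fin n) → ℝ) (l : ℝ≥0) : ℝ≥0∞ :=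
  ∫⁻ x, φ x (‖f x‖₊ / l)

/-- Membership in the Musielak-Orlicz space `L^φ(ℝⁿ)`. -/
def MemMO (φ : EuclideanSpace ℝ (Fin n) → ℝ≥0 → ℝ≥0∞)
    (f : EuclideanSpace ℝ (Fin n) → ℝ) : Prop :=
  AEStronglyMeasurable f volume ∧ ∃ l : ℝ≥0, 0 < l ∧ modular φ f l < ⊤

/-- The Luxemburg norm `inf {l > 0 : ∫ φ(x, |f(x)| / l) dx ≤ 1}`, equal to `∞` if there is no
such `l`. -/
noncomputable def luxNorm (φ : EuclideanSpace ℝ (Fin n) → ℝ≥0 → ℝ≥0∞)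
    (f : EuclideanSpace ℝ (Fin n) → ℝ) : ℝ≥0∞ :=
  ⨅ (l : ℝ≥0) (_ : 0 < l ∧ modular φ f l ≤ 1), (l : ℝ≥0∞)

/-- `u ∈ W^{1,1}_loc(ℝⁿ)` with weak gradient `G`. -/
structure HasWeakGradient (u : EuclideanSpace ℝ (Fin n) → ℝ)
    (G : EuclideanSpace ℝ (Fin n) → EuclideanSpace ℝ (Fin n)) : Prop where
  locallyIntegrable : LocallyIntegrable u volume
  locallyIntegrable_grad : LocallyIntegrable G volume
  integral_eq : ∀ ψ : EuclideanSpace ℝ (Fin n) → ℝ, ContDiff ℝ ∞ ψ → HasCompactSupport ψ →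
    ∀ i : Fin n,
      ∫ x, u x * fderiv ℝ ψ x (EuclideanSpace.single i 1) = -∫ x, G x i * ψ x

/-- The space `V_d^{1,φ}(ℝⁿ)`: functions in `W^{1,1}_loc(ℝⁿ)`, up to equality a.e., with
`|∇u| ∈ L^φ(ℝⁿ)` and `|{|u| > t}| < ∞` for every `t > 0`. -/
def Vd (φ : EuclideanSpace ℝ (Fin n) → ℝ≥0 → ℝ≥0∞) :
    Set (EuclideanSpace ℝ (Fin n) →ₘ[volume] ℝ) :=
  {u | (∃ G, HasWeakGradient u G ∧ MemMO φ (fun x => ‖G x‖)) ∧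
    ∀ t : ℝ, 0 < t → volume {x | t < |u x|} < ⊤}

end

/-- A normed function lattice on `ℝⁿ`: a linear space of (classes of) measurable functions with a
norm such that `|u| ≤ |v|` a.e. implies `‖u‖ ≤ ‖v‖`. -/
structure NormedFunctionLattice (n : ℕ) where
  /-- The underlying space. -/
  space : Submodule ℝ (EuclideanSpace ℝ (Fin n) →ₘ[volume] ℝ)
  /-- The norm. -/
  norm : Seminorm ℝ space
  eq_zero_of_norm_eq_zero : ∀ u : space, norm u = 0 → u = 0
  norm_mono : ∀ u v : space,
    (∀ᵐ x, |(u : EuclideanSpace ℝ (Fin n) →ₘ[volume] ℝ) x| ≤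
      |(v : EuclideanSpace ℝ (Fin n) →ₘ[volume] ℝ) x|) → norm u ≤ norm v

/-- `∫_0 (t / φ_∞(t))^{1/(n-1)} dt < ∞`: the integral converges near `0`. The quotient is `∞` where
`φ_∞(t) = 0` and `0` where `φ_∞(t) = ∞`. -/
def ConvZero {n : ℕ} (φ : EuclideanSpace ℝ (Fin n) → ℝ≥0 → ℝ≥0∞) : Prop :=
  ∃ δ : ℝ, 0 < δ ∧
    ∫⁻ t in Ioo 0 δ,
      (ENNReal.ofReal t / phiInf φ t.toNNReal) ^ (1 / ((n : ℝ) - 1)) < ⊤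

/-! The inequality is tested on sums of truncated cones, `u x = ∑ t j * max (r j - max ‖x‖ R) 0`
with `t j = δ / 2 ^ j` and free radii `r j`. Where the gradient is nonzero, it is a partial sum of a
geometric sequence, hence at most twice one active slope `t a`. Far from the origin (A2) replaces `φ
x` by `phiInf φ` up to a dilation and an integrable error, so the modular is at most `∑ phiInf φ (t
j) * |B (r j)|` plus a small tail (`modular_gradient_plateauSum_le`).

On the unit ball `u` is the constant `∑ t j * max (r j - R) 0`, so it dominates that multiple of a
fixed bump. The lattice property therefore bounds `∑ t j * r j` whenever the modular cost is at most
`1 / 2` (`exists_sum_mul_radius_le`).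

This is a discrete extremal problem. Rescaling the radii (`exists_sum_mul_le_of_cost`) allows the
choice `r j = (t j / phiInf φ (t j)) ^ (1 / (n - 1))`, and the bound becomes convergence of a dyadic
sum (`tsum_mul_rpow_le_of_sum_le`). Since `t / phiInf φ t` is nonincreasing, that sum controls the
integral. -/

namespace IsYoung

/-! ### Young functions and their left-continuous inverses. -/

variable {A : ℝ≥0 → ℝ≥0∞}

lemma map_mul_le (hA : IsYoung A) {a : ℝ≥0} (ha : a ≤ 1) (t : ℝ≥0) : A (a * t) ≤ a * A t := by
  have h := hA.convex.2 (mem_univ t) (mem_univ 0) (zero_le : 0 ≤ a) (zero_le : 0 ≤ 1 - a)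
    (add_tsub_cancel_of_le ha)
  simpa [hA.zero, ENNReal.smul_def] using h

lemma monotone (hA : IsYoung A) : Monotone A := by
  intro s t hst
  rcases eq_or_ne t 0 with rfl | ht
  · rw [nonpos_iff_eq_zero.1 hst]
  have h1 : s / t ≤ 1 := div_le_one_of_le₀ hst zero_le
  calc A s = A (s / t * t) := by rw [div_mul_cancel₀ s ht]
    _ ≤ (s / t : ℝ≥0) * A t := hA.map_mul_le h1 t
    _ ≤ 1 * A t := by gcongr; exact_mod_cast h1
    _ = A t := one_mul _

lemma exists_le_apply (hA : IsYoung A) (t : ℝ≥0) : ∃ τ, (t : ℝ≥0∞) ≤ A τ := by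
  obtain ⟨s, hs⟩ : ∃ s, A s ≠ 0 := by
    obtain ⟨s, t, hst⟩ := hA.nonconst
    by_contra! h
    exact hst (by rw [h s, h t])
  -- A finite positive lower bound for `A s`, which may be infinite; convexity gives `k * A s ≤ A (k
  -- * s)` for `k ≥ 1`.
  obtain ⟨ε, hε, hεs⟩ := ENNReal.lt_iff_exists_nnreal_btwn.1 (pos_iff_ne_zero.2 hs)
  have hε0 : 0 < ε := by exact_mod_cast hε
  set k : ℝ≥0 := max 1 (t / ε)
  have hk : 1 ≤ k := le_max_left _ _
  have hk0 : k ≠ 0 := (zero_lt_one.trans_le hk).ne'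
  refine ⟨k * s, ?_⟩
  have h : A s ≤ (k⁻¹ : ℝ≥0) * A (k * s) := by
    have := hA.map_mul_le (inv_le_one_of_one_le₀ hk) (k * s)
    rwa [inv_mul_cancel_left₀ hk0] at this
  calc (t : ℝ≥0∞) = ((t / ε * ε : ℝ≥0) : ℝ≥0∞) := by rw [div_mul_cancel₀ t hε0.ne']
    _ ≤ k * A s := by
      rw [ENNReal.coe_mul]
      gcongr
      exact le_max_right _ _
    _ ≤ k * ((k⁻¹ : ℝ≥0) * A (k * s)) := by gcongr
    _ = A (k * s) := by
      rw [← mul_assoc, ← ENNReal.coe_mul, mul_inv_cancel₀ hk0, ENNReal.coe_one, one_mul]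

lemma le_leftInv (hA : IsYoung A) {τ t : ℝ≥0} (h : A τ < t) : τ ≤ leftInv A t := by
  refine le_csInf (hA.exists_le_apply t) fun σ hσ => ?_
  by_contra! hlt
  exact absurd (h.trans_le hσ) (not_lt.2 (hA.monotone hlt.le))

/-- By continuity, if `A` exceeded `t` at `σ` it would already do so slightly to the left, putting
the infimum below `σ`. -/
lemma apply_le_of_le_leftInv (hA : IsYoung A) {σ t : ℝ≥0} (h : σ ≤ leftInv A t) : A σ ≤ t := by
  rcases eq_or_ne σ 0 with rfl | hσ
  · simp [hA.zero]
  by_contra! hlt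
  have hev : ∀ᶠ s in nhdsWithin σ (Iio σ), (t : ℝ≥0∞) < A s :=
    (hA.continuous.continuousAt.eventually_const_lt hlt).filter_mono nhdsWithin_le_nhds
  have : (nhdsWithin σ (Iio σ)).NeBot := nhdsLT_neBot_of_exists_lt ⟨0, pos_iff_ne_zero.2 hσ⟩
  obtain ⟨s, hs, hsσ⟩ := (hev.and self_mem_nhdsWithin).exists
  exact absurd (h.trans (csInf_le (OrderBot.bddBelow _) hs.le)) (not_le.2 hsσ)

end IsYoung

/-! ### Consequences of (A0) and (A2) for `φ` and `phiInf φ`. -/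

section

variable {n : ℕ} {φ : EuclideanSpace ℝ (Fin n) → ℝ≥0 → ℝ≥0∞}

lemma IsGenYoung.phiInf_mul_le (hφ : IsGenYoung φ) {a : ℝ≥0} (ha : a ≤ 1) (t : ℝ≥0) :
    phiInf φ (a * t) ≤ a * phiInf φ t := by
  unfold phiInf
  rw [← ENNReal.limsup_const_mul_of_ne_top ENNReal.coe_ne_top]
  refine limsup_le_limsup ?_
  filter_upwards [hφ.young.filter_mono (inf_le_right : Bornology.cobounded _ ⊓ ae volume ≤ _)]
    with x hx using hx.map_mul_le ha t

/-- Points far from the origin at which an integrable function is small. -/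
lemma MeasureTheory.Integrable.frequently_cobounded_le (hn : 0 < n)
    {h : EuclideanSpace ℝ (Fin n) → ℝ}
    (hh : Integrable h) {η : ℝ} (hη : 0 < η) :
    ∃ᶠ x in Bornology.cobounded (EuclideanSpace ℝ (Fin n)) ⊓ ae volume, |h x| < η := by
  intro hev
  rw [eventually_inf] at hev
  obtain ⟨s, hs, t, ht, hst⟩ := hev
  have hfin : volume {x | η ≤ ‖h x‖} < ⊤ := hh.measure_norm_ge_lt_top hη
  have : Nontrivial (EuclideanSpace ℝ (Fin n)) := by
    have : Nonempty (Fin n) := ⟨⟨0, hn⟩⟩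
    infer_instance
  have hb : volume sᶜ < ⊤ :=
    Bornology.IsBounded.measure_lt_top (Bornology.isBounded_def.2 (by simpa using hs))
  -- Otherwise a bounded set, a null set and a set of finite measure would cover the whole space.
  have hsub : (univ : Set (EuclideanSpace ℝ (Fin n))) ⊆ sᶜ ∪ tᶜ ∪ {x | η ≤ ‖h x‖} := by
    intro x _
    by_cases hxs : x ∈ s
    · by_cases hxt : x ∈ t
      · exact Or.inr (by simpa using hst x ⟨hxs, hxt⟩)
      · exact Or.inl (Or.inr hxt)
    · exact Or.inl (Or.inl hxs)
  have htop : volume (univ : Set (EuclideanSpace ℝ (Fin n))) = ⊤ := by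
    have := NormedSpace.noncompactSpace ℝ (EuclideanSpace ℝ (Fin n))
    exact measure_univ_of_isAddLeftInvariant _
  have ht0 : volume tᶜ = 0 := ht
  have hle := (measure_mono (μ := volume) hsub).trans
    ((measure_union_le _ _).trans (add_le_add_left (measure_union_le _ _) _))
  rw [htop, ht0, add_zero] at hle
  exact absurd hle (not_le.2 (ENNReal.add_lt_top.2 ⟨hb, hfin⟩))

lemma CondA0.ae_apply_le_one (hφ : IsGenYoung φ) (hA0 : CondA0 φ) :
    ∃ δ : ℝ≥0, 0 < δ ∧ ∀ᵐ x, ∀ σ ≤ δ, φ x σ ≤ 1 := by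
  obtain ⟨β, hβ, -, h⟩ := hA0
  refine ⟨β, hβ, ?_⟩
  filter_upwards [h, hφ.young] with x hx hy σ hσ
  simpa using hy.apply_le_of_le_leftInv (hσ.trans hx.1)

/-- Near `0`, the function `φ (x, ·)` is controlled by `phiInf φ` up to an integrable error. -/
lemma CondA2.ae_apply_le_phiInf_add (hn : 0 < n) (hφ : IsGenYoung φ) (hA2 : CondA2 φ) {δ : ℝ≥0}
    (hδ : ∀ᵐ x, ∀ σ ≤ δ, φ x σ ≤ 1) :
    ∃ b : ℝ≥0, 0 < b ∧ b ≤ 1 ∧ ∃ h : EuclideanSpace ℝ (Fin n) → ℝ, Integrable h ∧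
      ∀ τ ≤ δ, ∀ᵐ x, φ x (b * τ) ≤ phiInf φ τ + ‖h x‖ₑ := by
  obtain ⟨b, hb, hb1, h, hh, -, H⟩ := hA2 1 one_pos
  rw [memLp_one_iff_integrable] at hh
  refine ⟨b, hb, hb1, h, hh, fun τ hτ => ?_⟩
  -- Rational `t` and `η` allow the exceptional null sets in `y` to be united. A far point `x` with
  -- `|h x| < η` and `φ x τ < t` has `τ ≤ leftInv (φ x) t`, and (A2) carries this bound to `y`.
  have key : ∀ t η : ℚ, 0 < t → t ≤ 1 → 0 < η → phiInf φ τ < ENNReal.ofReal t →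
      ∀ᵐ y, |h y| + η ≤ t → φ y (b * τ) ≤ ENNReal.ofReal t := by
    intro t η ht ht1 hη hlt
    have hfar : ∀ᶠ x in Bornology.cobounded (EuclideanSpace ℝ (Fin n)) ⊓ ae volume,
        φ x τ < ENNReal.ofReal t := eventually_lt_of_limsup_lt hlt
    have hae := (H.and hφ.young).filter_mono
      (inf_le_right : Bornology.cobounded (EuclideanSpace ℝ (Fin n)) ⊓ ae volume ≤ _)
    obtain ⟨x, hxη, hxt, hxH, hxY⟩ :=
      ((hh.frequently_cobounded_le hn (Rat.cast_pos.2 hη)).and_eventually (hfar.and hae)).exists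
    filter_upwards [hxH, hφ.young] with y hy hyY hle
    refine hyY.apply_le_of_le_leftInv ((mul_le_mul_right (hxY.le_leftInv hxt) b).trans
      (hy (t : ℝ).toNNReal ?_ ?_))
    · rw [Real.coe_toNNReal _ (by positivity)]
      linarith [le_abs_self (h x), le_abs_self (h y)]
    · rw [Real.toNNReal_le_one]
      exact_mod_cast ht1
  have key' : ∀ᵐ y, ∀ t η : ℚ, 0 < t → t ≤ 1 → 0 < η → phiInf φ τ < ENNReal.ofReal t →
      |h y| + η ≤ t → φ y (b * τ) ≤ ENNReal.ofReal t := by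
    simpa only [ae_all_iff] using key
  filter_upwards [key', hδ] with y hy hy1
  by_contra! hlt
  -- The level `q` lies above both `phiInf φ τ` and `|h y|`, yet below `φ y (b * τ) ≤ 1`, so it is
  -- in the range of (A2) with `s = 1`.
  obtain ⟨q, hq0, hq, hqφ⟩ := ENNReal.lt_iff_exists_rat_btwn.1
    ((max_le le_self_add le_add_self).trans_lt hlt :
      max (phiInf φ τ) ‖h y‖ₑ < φ y (b * τ))
  have hle1 : φ y (b * τ) ≤ 1 :=
    hy1 _ ((mul_le_of_le_one_left zero_le hb1).trans hτ)
  have hq' : phiInf φ τ < ENNReal.ofReal q := (le_max_left _ _).trans_lt hq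
  have hq'' : |h y| < q := by
    have : ‖h y‖ₑ < ENNReal.ofReal q := (le_max_right _ _).trans_lt hq
    rw [← ofReal_norm] at this
    exact (ENNReal.ofReal_lt_ofReal_iff_of_nonneg (norm_nonneg _)).1 this
  have hqpos : (0 : ℝ) < q := (abs_nonneg _).trans_lt hq''
  have hq1 : (q : ℝ) ≤ 1 := by
    have := (hqφ.trans_le hle1).le
    exact ENNReal.ofReal_le_one.1 this
  obtain ⟨η, hη0, hη⟩ := exists_rat_btwn (sub_pos.2 hq'')
  refine absurd (hy q η ?_ ?_ ?_ hq' (by linarith)) (not_le.2 hqφ)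
  · exact_mod_cast hqpos
  · exact_mod_cast hq1
  · exact_mod_cast hη0

end

/-! ### Weak gradients of Lipschitz functions and the radial test functions. -/

section

variable {n : ℕ}

lemma gradient_apply_eq_fderiv (u : EuclideanSpace ℝ (Fin n) → ℝ) (x : EuclideanSpace ℝ (Fin n))
    (i : Fin n) : gradient u x i = fderiv ℝ u x (EuclideanSpace.single i 1) := by
  rw [← toDual_gradient, InnerProductSpace.toDual_apply_apply,
    EuclideanSpace.inner_single_right]
  simp

lemma norm_gradient_eq (u : EuclideanSpace ℝ (Fin n) → ℝ) (x : EuclideanSpace ℝ (Fin n)) :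
    ‖gradient u x‖ = ‖fderiv ℝ u x‖ := by
  rw [gradient, LinearIsometryEquiv.norm_map]

lemma stronglyMeasurable_gradient (u : EuclideanSpace ℝ (Fin n) → ℝ) :
    StronglyMeasurable (gradient u) :=
  ((InnerProductSpace.toDual ℝ _).symm.continuous.measurable.comp
    (measurable_fderiv ℝ u)).stronglyMeasurable

/-- A Lipschitz function belongs to `W^{1,1}_loc`; its weak gradient is its a.e. gradient. -/
lemma LipschitzWith.hasWeakGradient {C : ℝ≥0} {u : EuclideanSpace ℝ (Fin n) → ℝ}
    (hu : LipschitzWith C u) : HasWeakGradient u (gradient u) where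
  locallyIntegrable := hu.continuous.locallyIntegrable
  locallyIntegrable_grad :=
    (locallyIntegrable_const (C : ℝ)).mono (stronglyMeasurable_gradient u).aestronglyMeasurable
      (ae_of_all _ fun x => by
        rw [norm_gradient_eq]
        exact (norm_fderiv_le_of_lipschitz ℝ hu).trans (le_abs_self _))
  integral_eq ψ hψ hψc i := by
    obtain ⟨D, hD⟩ := ContDiff.lipschitzWith_of_hasCompactSupport hψc hψ (by simp)
    have h := hu.integral_lineDeriv_mul_eq (μ := volume) hD hψc (EuclideanSpace.single i 1)
    have h1 : ∫ x, gradient u x i * ψ x =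
        ∫ x, lineDeriv ℝ u x (EuclideanSpace.single i 1) * ψ x := by
      refine integral_congr_ae ?_
      filter_upwards [hu.ae_differentiableAt (μ := volume)] with x hx
      rw [gradient_apply_eq_fderiv, hx.lineDeriv_eq_fderiv]
    rw [h1, h, ← integral_neg]
    congr 1 with x
    rw [((hψ.differentiable (by simp)) x).lineDeriv_eq_fderiv, map_neg]
    ring

lemma HasWeakGradient.congr_ae {u v : EuclideanSpace ℝ (Fin n) → ℝ}
    {G : EuclideanSpace ℝ (Fin n) → EuclideanSpace ℝ (Fin n)} (hu : HasWeakGradient u G)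
    (huv : u =ᵐ[volume] v) : HasWeakGradient v G where
  locallyIntegrable := hu.locallyIntegrable.congr huv
  locallyIntegrable_grad := hu.locallyIntegrable_grad
  integral_eq ψ hψ hψc i := by
    rw [← hu.integral_eq ψ hψ hψc i]
    refine integral_congr_ae ?_
    filter_upwards [huv] with x hx
    rw [hx]

variable {φ : EuclideanSpace ℝ (Fin n) → ℝ≥0 → ℝ≥0∞}

lemma LipschitzWith.mk_mem_Vd {C : ℝ≥0} {u : EuclideanSpace ℝ (Fin n) → ℝ}
    (hu : LipschitzWith C u) (huc : HasCompactSupport u) {l : ℝ≥0} (hl : 0 < l)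
    (hm : modular φ (fun x => ‖gradient u x‖) l < ⊤) :
    AEEqFun.mk u hu.continuous.aestronglyMeasurable ∈ Vd φ := by
  have hae := AEEqFun.coeFn_mk u (hu.continuous.aestronglyMeasurable (μ := volume))
  refine ⟨⟨gradient u, hu.hasWeakGradient.congr_ae hae.symm,
    (stronglyMeasurable_gradient u).norm.aestronglyMeasurable, l, hl, hm⟩, fun t ht => ?_⟩
  refine lt_of_le_of_lt ?_ (huc.isCompact.measure_lt_top (μ := volume))
  refine measure_mono_ae ?_
  filter_upwards [hae] with x hx hxt
  refine subset_tsupport _ fun h0 => ?_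
  have hxt' : t < |(AEEqFun.mk u hu.continuous.aestronglyMeasurable :
    EuclideanSpace ℝ (Fin n) →ₘ[volume] ℝ) x| := hxt
  rw [hx, h0, abs_zero] at hxt'
  exact absurd hxt' (not_lt.2 ht.le)

/-- The function equal to `r - R` on the ball of radius `R` and decreasing with slope one to `0`
between the radii `R` and `r`. -/
noncomputable def radialPlateau (R r : ℝ) (x : EuclideanSpace ℝ (Fin n)) : ℝ :=
  max (r - max ‖x‖ R) 0

lemma lipschitzWith_radialPlateau (R r : ℝ) :
    LipschitzWith 1 (radialPlateau R r : EuclideanSpace ℝ (Fin n) → ℝ) := by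
  have h : LipschitzWith (0 + 1) (fun x : EuclideanSpace ℝ (Fin n) => r - max ‖x‖ R) :=
    (LipschitzWith.const r).sub (lipschitzWith_one_norm.max_const R)
  rw [zero_add] at h
  exact h.max_const 0

lemma radialPlateau_nonneg (R r : ℝ) (x : EuclideanSpace ℝ (Fin n)) :
    0 ≤ radialPlateau R r x := le_max_right _ _

lemma radialPlateau_eq_zero {R r : ℝ} {x : EuclideanSpace ℝ (Fin n)} (hx : r ≤ ‖x‖) :
    radialPlateau R r x = 0 :=
  max_eq_right (by linarith [le_max_left ‖x‖ R])

lemma fderiv_radialPlateau_eq_zero {R r : ℝ} {x : EuclideanSpace ℝ (Fin n)}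
    (hx : ‖x‖ < R ∨ r < ‖x‖) : fderiv ℝ (radialPlateau R r) x = 0 := by
  rcases hx with hx | hx
  · have : radialPlateau R r =ᶠ[nhds x] fun _ => max (r - R) 0 := by
      filter_upwards [continuous_norm.continuousAt.eventually_lt_const hx] with y hy
      rw [radialPlateau, max_eq_right hy.le]
    rw [this.fderiv_eq]; simp
  · have : radialPlateau R r =ᶠ[nhds x] fun _ => 0 := by
      filter_upwards [continuous_norm.continuousAt.eventually_const_lt hx] with y hy
      exact radialPlateau_eq_zero hy.le
    rw [this.fderiv_eq]; simp

lemma norm_fderiv_radialPlateau_le (R r : ℝ) (x : EuclideanSpace ℝ (Fin n)) :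
    ‖fderiv ℝ (radialPlateau R r) x‖ ≤ 1 := by
  simpa using norm_fderiv_le_of_lipschitz ℝ (lipschitzWith_radialPlateau (n := n) R r) (x₀ := x)

/-- A nonnegative combination of radial plateaus over a common ball. -/
noncomputable def plateauSum (R : ℝ) (t r : ℕ → ℝ≥0) (N : ℕ) (x : EuclideanSpace ℝ (Fin n)) : ℝ :=
  ∑ j ∈ Finset.range N, (t j : ℝ) * radialPlateau R (r j) x

lemma exists_lipschitzWith_plateauSum (R : ℝ) (t r : ℕ → ℝ≥0) (N : ℕ) :
    ∃ C, LipschitzWith C (plateauSum R t r N : EuclideanSpace ℝ (Fin n) → ℝ) := by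
  induction N with
  | zero => exact ⟨0, by simp [plateauSum]⟩
  | succ N ih =>
    obtain ⟨C, hC⟩ := ih
    have h : (plateauSum R t r (N + 1) : EuclideanSpace ℝ (Fin n) → ℝ) =
        fun x => plateauSum R t r N x + (t N : ℝ) • radialPlateau R (r N) x := by
      ext x; simp [plateauSum, Finset.sum_range_succ]
    rw [h]
    exact ⟨_, hC.add ((lipschitzWith_smul (t N : ℝ)).comp (lipschitzWith_radialPlateau R (r N)))⟩

lemma hasCompactSupport_plateauSum (R : ℝ) (t r : ℕ → ℝ≥0) (N : ℕ) :
    HasCompactSupport (plateauSum R t r N : EuclideanSpace ℝ (Fin n) → ℝ) := by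
  refine HasCompactSupport.intro
    (isCompact_closedBall 0 ((∑ j ∈ Finset.range N, r j : ℝ≥0) : ℝ)) fun x hx => ?_
  refine Finset.sum_eq_zero fun j hj => ?_
  rw [radialPlateau_eq_zero, mul_zero]
  have h1 : ((∑ j ∈ Finset.range N, r j : ℝ≥0) : ℝ) < ‖x‖ := by simpa using hx
  exact le_trans (by exact_mod_cast Finset.single_le_sum (f := r) (fun _ _ => zero_le) hj) h1.le

/-- Each plateau is 1-Lipschitz and locally constant off the closed shell between `R` and `r j`;
Rademacher's theorem permits differentiating the sum termwise. -/
lemma ae_norm_gradient_plateauSum_le (R : ℝ) (t r : ℕ → ℝ≥0) (N : ℕ) :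
    ∀ᵐ x : EuclideanSpace ℝ (Fin n), ‖gradient (plateauSum R t r N) x‖ ≤
      ∑ j ∈ Finset.range N with R ≤ ‖x‖ ∧ ‖x‖ ≤ r j, (t j : ℝ) := by
  have hd : ∀ᵐ x : EuclideanSpace ℝ (Fin n), ∀ j : ℕ,
      DifferentiableAt ℝ (radialPlateau R (r j)) x :=
    ae_all_iff.2 fun j => (lipschitzWith_radialPlateau R (r j)).ae_differentiableAt
  filter_upwards [hd] with x hx
  have h : fderiv ℝ (plateauSum R t r N) x =
      ∑ j ∈ Finset.range N, (t j : ℝ) • fderiv ℝ (radialPlateau R (r j)) x := by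
    refine HasFDerivAt.fderiv ?_
    unfold plateauSum
    exact HasFDerivAt.fun_sum fun j _ => (hx j).hasFDerivAt.const_mul _
  rw [norm_gradient_eq, h, Finset.sum_filter]
  refine (norm_sum_le _ _).trans (Finset.sum_le_sum fun j _ => ?_)
  split_ifs with hj
  · rw [norm_smul, Real.norm_of_nonneg (t j).coe_nonneg]
    exact mul_le_of_le_one_right (t j).coe_nonneg (norm_fderiv_radialPlateau_le _ _ _)
  · rw [fderiv_radialPlateau_eq_zero, smul_zero, norm_zero]
    rwa [not_and_or, not_le, not_le] at hj

end

/-- A sum of distinct terms of the sequence `δ / 2 ^ j` is at most twice its largest term. -/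
lemma exists_sum_geometric_le (δ : ℝ) (hδ : 0 ≤ δ) {s : Finset ℕ} (hs : s.Nonempty) :
    ∃ a ∈ s, ∑ j ∈ s, δ / 2 ^ j ≤ 2 * (δ / 2 ^ a) := by
  refine ⟨s.min' hs, s.min'_mem hs, ?_⟩
  set a := s.min' hs
  have h1 : ∀ N, ∑ j ∈ Finset.range N, δ / 2 ^ (a + j) ≤
      2 * (δ / 2 ^ a) - 2 * (δ / 2 ^ (a + N)) := by
    intro N
    induction N with
    | zero => simp
    | succ N ih =>
      rw [Finset.sum_range_succ]
      have : δ / 2 ^ (a + (N + 1)) = δ / 2 ^ (a + N) / 2 := by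
        rw [← add_assoc, pow_succ, div_div]
      linarith
  have hsub : s ⊆ Finset.Ico a (s.max' hs + 1) := fun j hj =>
    Finset.mem_Ico.2 ⟨s.min'_le j hj, Nat.lt_succ_of_le (s.le_max' j hj)⟩
  refine (Finset.sum_le_sum_of_subset_of_nonneg hsub fun _ _ _ => by positivity).trans ?_
  rw [Finset.sum_Ico_eq_sum_range]
  refine (h1 _).trans ?_
  have : 0 ≤ δ / 2 ^ (a + (s.max' hs + 1 - a)) := by positivity
  linarith

lemma exists_setLIntegral_compl_ball_le {E : Type*} [NormedAddCommGroup E] [MeasurableSpace E]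
    [OpensMeasurableSpace E] {μ : Measure E} {h : E → ℝ} (hh : Integrable h μ) {ε : ℝ≥0∞}
    (hε : 0 < ε) :
    ∃ R : ℝ, 1 ≤ R ∧ ∫⁻ x in (Metric.ball 0 R)ᶜ, ‖h x‖ₑ ∂μ ≤ ε := by
  -- A finite measure, so continuity from above applies to the complements of growing balls.
  set ν := μ.withDensity fun x => ‖h x‖ₑ
  have hν : ν univ ≠ ⊤ := by
    rw [withDensity_apply _ MeasurableSet.univ, Measure.restrict_univ]
    exact hh.2.ne
  have ht := tendsto_measure_iInter_atTop (μ := ν) (s := fun k : ℕ => (Metric.ball (0 : E) k)ᶜ)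
    (fun k => Metric.isOpen_ball.measurableSet.compl.nullMeasurableSet)
    (fun i j hij => compl_subset_compl.2 (Metric.ball_subset_ball (by exact_mod_cast hij)))
    ⟨0, ne_top_of_le_ne_top hν (measure_mono (subset_univ _))⟩
  have hemp : ⋂ k : ℕ, (Metric.ball (0 : E) k)ᶜ = ∅ := by
    rw [← compl_iUnion, Metric.iUnion_ball_nat, compl_univ]
  rw [hemp, measure_empty] at ht
  obtain ⟨k, hk1, hk⟩ := ((eventually_ge_atTop 1).and (ht.eventually_lt_const hε)).exists
  refine ⟨k, by exact_mod_cast hk1, ?_⟩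
  have : ν (Metric.ball (0 : E) k)ᶜ < ε := hk
  rw [withDensity_apply _ Metric.isOpen_ball.measurableSet.compl] at this
  exact this.le

/-! ### Modular estimates and the bound obtained from the lattice norm. -/

section

variable {n : ℕ} {φ : EuclideanSpace ℝ (Fin n) → ℝ≥0 → ℝ≥0∞}

/-- The divisor `2 / b` absorbs the factor 2 of the geometric sum and supplies the dilation `b` lost
in (A2). Thus a single active index controls the integrand at each point, and the sum over all `j`
only makes the bound independent of that index. -/
lemma modular_gradient_plateauSum_le (hφ : IsGenYoung φ) {b δ : ℝ≥0} (hb : 0 < b)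
    {h : EuclideanSpace ℝ (Fin n) → ℝ}
    (H : ∀ τ ≤ δ, ∀ᵐ x, φ x (b * τ) ≤ phiInf φ τ + ‖h x‖ₑ) (R : ℝ) (r : ℕ → ℝ≥0) (N : ℕ) :
    modular φ (fun x => ‖gradient (plateauSum R (fun j => δ / 2 ^ j) r N) x‖) (2 / b) ≤
      ∑ j ∈ Finset.range N, phiInf φ (δ / 2 ^ j) *
        volume (Metric.closedBall (0 : EuclideanSpace ℝ (Fin n)) (r j)) +
      ∫⁻ x in (Metric.ball 0 R)ᶜ, ‖h x‖ₑ := by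
  have hms : ∀ j, Measurable ((Metric.closedBall (0 : EuclideanSpace ℝ (Fin n)) (r j)).indicator
      fun _ => phiInf φ (δ / 2 ^ j)) := fun j =>
    measurable_const.indicator Metric.isClosed_closedBall.measurableSet
  calc modular φ (fun x => ‖gradient (plateauSum R (fun j => δ / 2 ^ j) r N) x‖) (2 / b)
      ≤ ∫⁻ x, (∑ j ∈ Finset.range N,
          (Metric.closedBall (0 : EuclideanSpace ℝ (Fin n)) (r j)).indicator
            (fun _ => phiInf φ (δ / 2 ^ j)) x) +
          ((Metric.ball 0 R)ᶜ).indicator (fun x => ‖h x‖ₑ) x := by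
        refine lintegral_mono_ae ?_
        have H' : ∀ᵐ x, ∀ j : ℕ, φ x (b * (δ / 2 ^ j)) ≤ phiInf φ (δ / 2 ^ j) + ‖h x‖ₑ :=
          ae_all_iff.2 fun j => H _ (div_le_self zero_le (one_le_pow₀ one_le_two))
        filter_upwards [H', hφ.young,
          ae_norm_gradient_plateauSum_le R (fun j => δ / 2 ^ j) r N] with x hx hY hG
        rcases (Finset.filter (fun j => R ≤ ‖x‖ ∧ ‖x‖ ≤ r j) (Finset.range N)).eq_empty_or_nonempty
          with he | hne
        · rw [he, Finset.sum_empty] at hG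
          have h0 : gradient (plateauSum R (fun j => δ / 2 ^ j) r N) x = 0 := norm_le_zero_iff.1 hG
          simp [h0, hY.zero]
        · obtain ⟨a, ha, hsum⟩ := exists_sum_geometric_le (δ : ℝ) δ.coe_nonneg hne
          rw [Finset.mem_filter] at ha
          have hG' : ‖‖gradient (plateauSum R (fun j => δ / 2 ^ j) r N) x‖‖₊ ≤
              2 * (δ / 2 ^ a) := by
            rw [← NNReal.coe_le_coe, coe_nnnorm, norm_norm]
            push_cast at hG ⊢
            exact hG.trans hsum
          have hle : ‖‖gradient (plateauSum R (fun j => δ / 2 ^ j) r N) x‖‖₊ / (2 / b) ≤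
              b * (δ / 2 ^ a) := by
            rw [div_le_iff₀ (by positivity)]
            refine hG'.trans (le_of_eq ?_)
            field_simp
          refine (hY.monotone hle).trans ((hx a).trans ?_)
          have h1 : x ∈ Metric.closedBall (0 : EuclideanSpace ℝ (Fin n)) (r a) := by
            simpa using ha.2.2
          have h2 : x ∈ (Metric.ball (0 : EuclideanSpace ℝ (Fin n)) R)ᶜ := by simpa using ha.2.1
          rw [indicator_of_mem h2]
          gcongr
          calc phiInf φ (δ / 2 ^ a)
              = (Metric.closedBall (0 : EuclideanSpace ℝ (Fin n)) (r a)).indicator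
                (fun _ => phiInf φ (δ / 2 ^ a)) x := by rw [indicator_of_mem h1]
            _ ≤ _ := Finset.single_le_sum (f := fun j =>
                (Metric.closedBall (0 : EuclideanSpace ℝ (Fin n)) (r j)).indicator
                (fun _ => phiInf φ (δ / 2 ^ j)) x) (fun _ _ => zero_le) ha.1
    _ = _ := by
        rw [lintegral_add_left (Finset.measurable_fun_sum _ fun j _ => hms j),
          lintegral_finsetSum _ fun j _ => hms j,
          lintegral_indicator Metric.isOpen_ball.measurableSet.compl]
        congr 1
        refine Finset.sum_congr rfl fun j _ => ?_
        rw [lintegral_indicator_const Metric.isClosed_closedBall.measurableSet]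

lemma luxNorm_le_of_modular_le_one {f : EuclideanSpace ℝ (Fin n) → ℝ} {l : ℝ≥0} (hl : 0 < l)
    (h : modular φ f l ≤ 1) : luxNorm φ f ≤ l :=
  iInf₂_le (f := fun (l : ℝ≥0) (_ : 0 < l ∧ modular φ f l ≤ 1) => (l : ℝ≥0∞)) l ⟨hl, h⟩

/-- This puts the fixed comparison bump into `Vd φ`, hence into the lattice. -/
lemma modular_gradient_radialPlateau_lt_top (hφ : IsGenYoung φ) {δ : ℝ≥0} (hδ0 : 0 < δ)
    (hδ : ∀ᵐ x, ∀ σ ≤ δ, φ x σ ≤ 1) (R r : ℝ) :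
    modular φ (fun x => ‖gradient (radialPlateau R r) x‖) (1 / δ) < ⊤ := by
  refine lt_of_le_of_lt (lintegral_mono_ae (g := (Metric.closedBall 0 r).indicator 1) ?_) ?_
  · filter_upwards [hδ, hφ.young] with x hx hY
    by_cases hxr : x ∈ Metric.closedBall (0 : EuclideanSpace ℝ (Fin n)) r
    · rw [indicator_of_mem hxr]
      refine hx _ ?_
      rw [div_le_iff₀ (by positivity), mul_one_div_cancel hδ0.ne', ← NNReal.coe_le_coe,
        coe_nnnorm, norm_norm, norm_gradient_eq]
      exact norm_fderiv_radialPlateau_le _ _ _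
    · have h0 : ‖gradient (radialPlateau R r) x‖ = 0 := by
        rw [norm_gradient_eq, fderiv_radialPlateau_eq_zero (Or.inr (by simpa using hxr)), norm_zero]
      simp [h0, hY.zero]
  · rw [lintegral_indicator_one Metric.isClosed_closedBall.measurableSet]
    exact measure_closedBall_lt_top

/-- The gradient estimate bounds the plateaus of all test functions of unit modular. -/
lemma exists_sum_mul_radius_le (hn : 0 < n) (hφ : IsGenYoung φ) (hA0 : CondA0 φ) (hA2 : CondA2 φ)
    (Y : NormedFunctionLattice n) (c : ℝ≥0)
    (hY : ∀ u ∈ Vd φ, ∃ hu : u ∈ Y.space, ∀ G, HasWeakGradient u G →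
      ENNReal.ofReal (Y.norm ⟨u, hu⟩) ≤ c * luxNorm φ (fun x => ‖G x‖)) :
    ∃ δ : ℝ≥0, 0 < δ ∧ ∃ M : ℝ≥0, ∀ (r : ℕ → ℝ≥0) (N : ℕ),
      ∑ j ∈ Finset.range N, phiInf φ (δ / 2 ^ j) *
        volume (Metric.closedBall (0 : EuclideanSpace ℝ (Fin n)) (r j)) ≤ 1 / 2 →
      ∑ j ∈ Finset.range N, δ / 2 ^ j * r j ≤ M := by
  obtain ⟨δ, hδ0, hδ⟩ := hA0.ae_apply_le_one hφ
  obtain ⟨b, hb, -, h, hh, H⟩ := hA2.ae_apply_le_phiInf_add hn hφ hδ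
  -- Half of the unit modular is spent on the error `h`, the other half on the cost; `1 ≤ R` places
  -- the unit ball inside every plateau.
  obtain ⟨R, hR1, hR⟩ := exists_setLIntegral_compl_ball_le hh (ε := 1 / 2) (by simp)
  have hl : 0 < 2 / b := by positivity
  set v : EuclideanSpace ℝ (Fin n) → ℝ := radialPlateau 0 1
  have hvL : LipschitzWith 1 v := lipschitzWith_radialPlateau 0 1
  have hvc : HasCompactSupport v :=
    HasCompactSupport.intro (isCompact_closedBall 0 1) fun x hx =>
      radialPlateau_eq_zero (le_of_lt (by simpa using hx))
  obtain ⟨hv, -⟩ := hY _ (hvL.mk_mem_Vd hvc (by positivity)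
    (modular_gradient_radialPlateau_lt_top hφ hδ0 hδ 0 1))
  set q := Y.norm ⟨_, hv⟩
  have hq0 : 0 < q := by
    refine (apply_nonneg Y.norm _).lt_of_ne fun h0 => ?_
    have h1 := congrArg Subtype.val (Y.eq_zero_of_norm_eq_zero _ h0.symm)
    have h2 : v =ᵐ[volume] fun _ => 0 := by
      have h3 := AEEqFun.coeFn_mk v (hvL.continuous.aestronglyMeasurable (μ := volume))
      have h4 := AEEqFun.coeFn_zero (α := EuclideanSpace ℝ (Fin n)) (β := ℝ) (μ := volume)
      simp only [ZeroMemClass.coe_zero] at h1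
      rw [h1] at h3
      exact h3.symm.trans h4
    have h5 := congrFun ((hvL.continuous.ae_eq_iff_eq volume continuous_const).1 h2) 0
    simp [v, radialPlateau] at h5
  -- The first term bounds the plateau height `P`; the second pays for replacing `max (r j - R) 0`
  -- by `r j`, as the slopes sum to at most `2 * δ`.
  refine ⟨δ, hδ0, (c * (2 / b) / q + 2 * δ * R).toNNReal, fun r N hcost => ?_⟩
  set t : ℕ → ℝ≥0 := fun j => δ / 2 ^ j
  obtain ⟨C, hC⟩ := exists_lipschitzWith_plateauSum (n := n) R t r N
  set u : EuclideanSpace ℝ (Fin n) → ℝ := plateauSum R t r N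
  have hmod : modular φ (fun x => ‖gradient u x‖) (2 / b) ≤ 1 :=
    (modular_gradient_plateauSum_le hφ hb H R r N).trans
      ((add_le_add hcost hR).trans (by simp [ENNReal.inv_two_add_inv_two]))
  obtain ⟨hu, hbound⟩ := hY _ (hC.mk_mem_Vd (hasCompactSupport_plateauSum R t r N) hl
    (hmod.trans_lt ENNReal.one_lt_top))
  have hnorm : Y.norm ⟨_, hu⟩ ≤ c * (2 / b) := by
    have h1 := (hbound _ (hC.hasWeakGradient.congr_ae (AEEqFun.coeFn_mk u
      (hC.continuous.aestronglyMeasurable (μ := volume))).symm)).trans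
      (mul_le_mul_right (luxNorm_le_of_modular_le_one hl hmod) (c : ℝ≥0∞))
    rw [← ENNReal.coe_mul, ← ENNReal.ofReal_coe_nnreal,
      ENNReal.ofReal_le_ofReal_iff (NNReal.coe_nonneg _)] at h1
    exact_mod_cast h1
  set P : ℝ := ∑ j ∈ Finset.range N, (t j : ℝ) * max (r j - R) 0
  have hP0 : 0 ≤ P := Finset.sum_nonneg fun j _ => by positivity
  have hvu : ∀ x, |P * v x| ≤ |u x| := by
    intro x
    rw [abs_of_nonneg (mul_nonneg hP0 (radialPlateau_nonneg _ _ _))]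
    rcases le_or_gt 1 ‖x‖ with hx | hx
    · rw [radialPlateau_eq_zero hx, mul_zero]
      exact abs_nonneg _
    · have h1 : u x = P := by
        refine Finset.sum_congr rfl fun j _ => ?_
        rw [radialPlateau, max_eq_right (hx.le.trans hR1)]
      have h2 : v x ≤ 1 := max_le (by linarith [le_max_right ‖x‖ 0]) zero_le_one
      rw [h1, abs_of_nonneg hP0]
      exact mul_le_of_le_one_right hP0 h2
  have hPq : P * q ≤ c * (2 / b) := by
    refine le_trans (le_of_eq ?_) ((Y.norm_mono (P • ⟨_, hv⟩) ⟨_, hu⟩ ?_).trans hnorm)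
    · rw [map_smul_eq_mul, Real.norm_of_nonneg hP0]
    · have e1 := AEEqFun.coeFn_mk u (hC.continuous.aestronglyMeasurable (μ := volume))
      have e2 := AEEqFun.coeFn_mk v (hvL.continuous.aestronglyMeasurable (μ := volume))
      have e3 := AEEqFun.coeFn_smul P
        (AEEqFun.mk v (hvL.continuous.aestronglyMeasurable (μ := volume)))
      filter_upwards [e1, e2, e3] with x h1 h2 h3
      rw [SetLike.val_smul, h3, h1, Pi.smul_apply, h2, smul_eq_mul]
      exact hvu x
  have hsumt : ∑ j ∈ Finset.range N, (t j : ℝ) ≤ 2 * δ := by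
    rcases (Finset.range N).eq_empty_or_nonempty with he | hne
    · rw [he, Finset.sum_empty]; positivity
    · obtain ⟨a, -, ha⟩ := exists_sum_geometric_le (δ : ℝ) δ.coe_nonneg hne
      have : (δ : ℝ) / 2 ^ a ≤ δ := div_le_self δ.coe_nonneg (one_le_pow₀ one_le_two)
      simp only [t, NNReal.coe_div, NNReal.coe_pow, NNReal.coe_ofNat]
      linarith
  refine NNReal.le_toNNReal_of_coe_le ?_
  rw [NNReal.coe_sum]
  calc ∑ j ∈ Finset.range N, ((t j * r j : ℝ≥0) : ℝ)
      ≤ ∑ j ∈ Finset.range N, ((t j : ℝ) * max (r j - R) 0 + t j * R) := by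
        refine Finset.sum_le_sum fun j _ => ?_
        rw [← mul_add, NNReal.coe_mul]
        exact mul_le_mul_of_nonneg_left (by linarith [le_max_left ((r j : ℝ) - R) 0])
          (t j).coe_nonneg
    _ = P + (∑ j ∈ Finset.range N, (t j : ℝ)) * R := by
        rw [Finset.sum_add_distrib, Finset.sum_mul]
    _ ≤ c * (2 / b) / q + 2 * δ * R :=
        add_le_add ((le_div_iff₀ hq0).2 hPq) (by gcongr)

end

/-! ### The discrete extremal problem. -/

/-- Scaling the radii turns a bound under a cost constraint into a bound on admissible sequences. -/
lemma exists_sum_mul_le_of_cost {n : ℕ} (hn : 2 ≤ n) {κ : ℝ≥0} {A : ℕ → ℝ≥0∞}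
    {t : ℕ → ℝ≥0} {M : ℝ≥0}
    (H : ∀ (r : ℕ → ℝ≥0) (N : ℕ), ∑ j ∈ Finset.range N, A j * ((r j : ℝ≥0∞) ^ n * κ) ≤ 1 / 2 →
      ∑ j ∈ Finset.range N, t j * r j ≤ M) :
    ∃ M' : ℝ≥0, ∀ (r : ℕ → ℝ≥0) (N : ℕ), (∀ j, A j * (r j : ℝ≥0∞) ^ (n - 1) ≤ t j) →
      ∑ j ∈ Finset.range N, t j * r j ≤ M' := by
  refine ⟨max 1 (M ^ n * (2 * (κ + 1))), fun r N hr => ?_⟩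
  set S := ∑ j ∈ Finset.range N, t j * r j with hS
  by_contra! hlt
  have hS1 : 1 < S := (le_max_left _ _).trans_lt hlt
  have hS0 : S ≠ 0 := (zero_lt_one.trans hS1).ne'
  -- Admissible radii multiplied by `K` cost at most `K ^ n * κ * S ≤ 1 / 2`, so `K * S ≤ M`. Raised
  -- to the power `n`, this bounds `S ^ (n - 1)`, and `S` itself because `S > 1`.
  obtain ⟨K, hK⟩ : ∃ K : ℝ≥0, K ^ n = (S * (2 * (κ + 1)))⁻¹ :=
    ⟨_, NNReal.rpow_inv_natCast_pow _ (by omega)⟩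
  have hcost : ∑ j ∈ Finset.range N, A j * (((K * r j : ℝ≥0) : ℝ≥0∞) ^ n * κ) ≤ 1 / 2 := by
    calc ∑ j ∈ Finset.range N, A j * (((K * r j : ℝ≥0) : ℝ≥0∞) ^ n * κ)
        ≤ ∑ j ∈ Finset.range N, ((K ^ n * κ * (t j * r j) : ℝ≥0) : ℝ≥0∞) := by
          refine Finset.sum_le_sum fun j _ => ?_
          obtain ⟨m, rfl⟩ : ∃ m, n = m + 1 := ⟨n - 1, by omega⟩
          calc A j * (((K * r j : ℝ≥0) : ℝ≥0∞) ^ (m + 1) * κ)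
              = (K ^ (m + 1) * κ) * (A j * (r j : ℝ≥0∞) ^ m * r j) := by push_cast; ring
            _ ≤ (K ^ (m + 1) * κ) * (t j * r j) := by gcongr; exact hr j
            _ = _ := by push_cast; ring
      _ = ((K ^ n * κ * S : ℝ≥0) : ℝ≥0∞) := by
          rw [← ENNReal.ofNNReal_finsetSum, ← Finset.mul_sum]
      _ ≤ ((1 / 2 : ℝ≥0) : ℝ≥0∞) := by
          rw [ENNReal.coe_le_coe, hK]
          have : (S * (2 * (κ + 1)))⁻¹ * κ * S = κ / (κ + 1) * (1 / 2) := by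
            field_simp
          rw [this]
          exact mul_le_of_le_one_left zero_le (div_le_one_of_le₀ le_self_add zero_le)
      _ = 1 / 2 := by simp
  have h1 := H (fun j => K * r j) N hcost
  have h2 : K * S ≤ M := by
    refine le_trans (le_of_eq ?_) h1
    rw [hS, Finset.mul_sum]
    exact Finset.sum_congr rfl fun j _ => by ring
  have h3 : K ^ n * S ^ n ≤ M ^ n := by rw [← mul_pow]; gcongr
  have h4 : S ≤ M ^ n * (2 * (κ + 1)) := by
    obtain ⟨m, rfl⟩ : ∃ m, n = m + 1 := ⟨n - 1, by omega⟩
    have h5 : K ^ (m + 1) * S ^ (m + 1) = S ^ m / (2 * (κ + 1)) := by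
      rw [hK, pow_succ]; field_simp
    rw [h5, div_le_iff₀ (by positivity)] at h3
    exact (le_self_pow hS1.le (by omega)).trans h3
  exact absurd (h4.trans (le_max_right _ _)) (not_le.2 hlt)

/-- The largest admissible radii are inserted; they are finite because no `A j` vanishes. -/
lemma tsum_mul_rpow_le_of_sum_le {n : ℕ} (hn : 2 ≤ n) {A : ℕ → ℝ≥0∞}
    {t : ℕ → ℝ≥0} (ht : ∀ j, 0 < t j) {M : ℝ≥0}
    (H : ∀ (r : ℕ → ℝ≥0) (N : ℕ), (∀ j, A j * (r j : ℝ≥0∞) ^ (n - 1) ≤ t j) →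
      ∑ j ∈ Finset.range N, t j * r j ≤ M) :
    ∑' j, (t j : ℝ≥0∞) * ((t j : ℝ≥0∞) / A j) ^ (1 / ((n : ℝ) - 1)) ≤ M := by
  have hn1 : 0 < (n : ℝ) - 1 := by
    have : (2 : ℝ) ≤ n := by exact_mod_cast hn
    linarith
  have hA : ∀ j, A j ≠ 0 := by
    intro j hj
    -- If `A j = 0`, the radius at `j` is unconstrained and one term alone reaches `M + 1`.
    have h := H (Pi.single j ((M + 1) / t j)) (j + 1) fun i => by
      rcases eq_or_ne i j with rfl | hij
      · simp [hj]
      · simp [hij, show n - 1 ≠ 0 by omega]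
    rw [Finset.sum_eq_single j (fun i _ hij => by simp [hij]) (by simp), Pi.single_eq_same,
      mul_div_cancel₀ _ (ht j).ne'] at h
    exact absurd h (not_le.2 (lt_add_one M))
  have hfin : ∀ j, ((t j : ℝ≥0∞) / A j) ^ (1 / ((n : ℝ) - 1)) ≠ ⊤ := fun j =>
    ENNReal.rpow_ne_top_of_nonneg (by positivity) (ENNReal.div_ne_top ENNReal.coe_ne_top (hA j))
  set r : ℕ → ℝ≥0 := fun j => (((t j : ℝ≥0∞) / A j) ^ (1 / ((n : ℝ) - 1))).toNNReal
  have hr : ∀ j, (r j : ℝ≥0∞) = ((t j : ℝ≥0∞) / A j) ^ (1 / ((n : ℝ) - 1)) := fun j =>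
    ENNReal.coe_toNNReal (hfin j)
  have hadm : ∀ j, A j * (r j : ℝ≥0∞) ^ (n - 1) ≤ t j := by
    intro j
    rw [hr, ← ENNReal.rpow_natCast, ← ENNReal.rpow_mul, Nat.cast_sub (by omega), Nat.cast_one,
      one_div_mul_cancel hn1.ne', ENNReal.rpow_one]
    exact ENNReal.mul_div_le
  refine ENNReal.tsum_le_of_sum_range_le fun N => ?_
  simp_rw [← hr]
  exact_mod_cast H r N hadm

/-! ### From the dyadic sum to the integral, and the conclusion. -/

lemma IsGenYoung.div_phiInf_anti {n : ℕ} {φ : EuclideanSpace ℝ (Fin n) → ℝ≥0 → ℝ≥0∞}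
    (hφ : IsGenYoung φ) {s t : ℝ≥0} (hs : 0 < s) (hst : s ≤ t) :
    (t : ℝ≥0∞) / phiInf φ t ≤ s / phiInf φ s := by
  have ht : t ≠ 0 := (hs.trans_le hst).ne'
  have h := hφ.phiInf_mul_le (div_le_one_of_le₀ hst zero_le) t
  rw [div_mul_cancel₀ s ht] at h
  calc (t : ℝ≥0∞) / phiInf φ t
      = ((s / t : ℝ≥0) * t) / ((s / t : ℝ≥0) * phiInf φ t) :=
        (ENNReal.mul_div_mul_left _ _ (by simpa using ⟨hs.ne', ht⟩) ENNReal.coe_ne_top).symm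
    _ = s / ((s / t : ℝ≥0) * phiInf φ t) := by rw [← ENNReal.coe_mul, div_mul_cancel₀ s ht]
    _ ≤ s / phiInf φ s := by gcongr

lemma IsGenYoung.convZero_of_tsum_lt_top {n : ℕ} (hn : 2 ≤ n)
    {φ : EuclideanSpace ℝ (Fin n) → ℝ≥0 → ℝ≥0∞} (hφ : IsGenYoung φ) {δ : ℝ≥0} (hδ : 0 < δ)
    (H : ∑' j : ℕ, ((δ / 2 ^ j : ℝ≥0) : ℝ≥0∞) *
      (((δ / 2 ^ j : ℝ≥0) : ℝ≥0∞) / phiInf φ (δ / 2 ^ j)) ^ (1 / ((n : ℝ) - 1)) < ⊤) :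
    ConvZero φ := by
  have hn1 : 0 < (n : ℝ) - 1 := by
    have : (2 : ℝ) ≤ n := by exact_mod_cast hn
    linarith
  refine ⟨δ, hδ, lt_of_le_of_lt ?_ H⟩
  set t : ℕ → ℝ≥0 := fun j => δ / 2 ^ j
  have htpos : ∀ j, 0 < t j := fun j => by positivity
  have hsucc : ∀ j, (t j : ℝ) - t (j + 1) = t (j + 1) := fun j => by
    simp only [t, pow_succ]; push_cast; field_simp; norm_num
  have hcover : Ioo (0 : ℝ) δ ⊆ ⋃ j, Ioc (t (j + 1) : ℝ) (t j) := by
    intro x hx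
    have hex : ∃ j, (t j : ℝ) < x := by
      obtain ⟨j, hj⟩ := exists_pow_lt_of_lt_one (div_pos hx.1 (NNReal.coe_pos.2 hδ))
        (by norm_num : (1 / 2 : ℝ) < 1)
      refine ⟨j, ?_⟩
      rw [lt_div_iff₀ (NNReal.coe_pos.2 hδ)] at hj
      refine lt_of_eq_of_lt ?_ hj
      simp only [t]; push_cast; rw [one_div, inv_pow, div_eq_inv_mul]
    have h0 : Nat.find hex ≠ 0 := fun h => by
      have := Nat.find_spec hex
      rw [h] at this
      simp only [t, pow_zero, div_one] at this
      exact absurd this (not_lt.2 hx.2.le)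
    obtain ⟨k, hk⟩ := Nat.exists_eq_succ_of_ne_zero h0
    refine mem_iUnion.2 ⟨k, ?_, ?_⟩
    · have := Nat.find_spec hex
      rwa [hk] at this
    · exact not_lt.1 (Nat.find_min hex (by omega))
  calc ∫⁻ x in Ioo 0 (δ : ℝ), (ENNReal.ofReal x / phiInf φ x.toNNReal) ^ (1 / ((n : ℝ) - 1))
      ≤ ∑' j, ∫⁻ x in Ioc (t (j + 1) : ℝ) (t j),
          (ENNReal.ofReal x / phiInf φ x.toNNReal) ^ (1 / ((n : ℝ) - 1)) :=
        (lintegral_mono_set hcover).trans (lintegral_iUnion_le _ _)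
    _ ≤ ∑' j, (t (j + 1) : ℝ≥0∞) *
          ((t (j + 1) : ℝ≥0∞) / phiInf φ (t (j + 1))) ^ (1 / ((n : ℝ) - 1)) := by
        refine ENNReal.tsum_le_tsum fun j => ?_
        refine (setLIntegral_mono' measurableSet_Ioc (g := fun _ =>
          ((t (j + 1) : ℝ≥0∞) / phiInf φ (t (j + 1))) ^ (1 / ((n : ℝ) - 1)))
          fun x hx => ?_).trans (le_of_eq ?_)
        · refine ENNReal.rpow_le_rpow ?_ (by positivity)
          exact hφ.div_phiInf_anti (htpos _) (NNReal.le_toNNReal_of_coe_le hx.1.le)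
        · rw [setLIntegral_const, Real.volume_Ioc, hsucc, ENNReal.ofReal_coe_nnreal, mul_comm]
    -- The interval between `t (j + 1)` and `t j` has length `t (j + 1)` and is estimated at its
    -- left endpoint, so only the shifted series appears.
    _ ≤ _ := ENNReal.tsum_comp_le_tsum_of_injective (add_left_injective 1) fun j =>
        (t j : ℝ≥0∞) * ((t j : ℝ≥0∞) / phiInf φ (t j)) ^ (1 / ((n : ℝ) - 1))

theorem proposition3p4 (n : ℕ) (hn : 2 ≤ n)
    (φ : EuclideanSpace ℝ (Fin n) → ℝ≥0 → ℝ≥0∞)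
    (hφ : IsGenYoung φ) (hA0 : CondA0 φ) (hA1 : CondA1 φ) (hA2 : CondA2 φ)
    (Y : NormedFunctionLattice n) (c : ℝ≥0)
    (hY : ∀ u ∈ Vd φ, ∃ hu : u ∈ Y.space, ∀ G, HasWeakGradient u G →
      ENNReal.ofReal (Y.norm ⟨u, hu⟩) ≤ c * luxNorm φ (fun x => ‖G x‖)) :
    ConvZero φ := by
  obtain ⟨δ, hδ, M, hM⟩ := exists_sum_mul_radius_le (by omega) hφ hA0 hA2 Y c hY
  obtain ⟨κ, hκ⟩ : ∃ κ : ℝ≥0, (κ : ℝ≥0∞) =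
      volume (Metric.ball (0 : EuclideanSpace ℝ (Fin n)) 1) :=
    ⟨_, ENNReal.coe_toNNReal measure_ball_lt_top.ne⟩
  have hvol : ∀ r : ℝ≥0, volume (Metric.closedBall (0 : EuclideanSpace ℝ (Fin n)) r) =
      (r : ℝ≥0∞) ^ n * κ := fun r => by
    rw [Measure.addHaar_closedBall _ _ r.coe_nonneg, finrank_euclideanSpace_fin, ← hκ,
      ENNReal.ofReal_pow r.coe_nonneg, ENNReal.ofReal_coe_nnreal]
  simp only [hvol] at hM
  obtain ⟨M', hM'⟩ := exists_sum_mul_le_of_cost hn hM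
  exact hφ.convZero_of_tsum_lt_top hn hδ
    ((tsum_mul_rpow_le_of_sum_le hn (fun j => by positivity) hM').trans_lt ENNReal.coe_lt_top)
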